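/- Let $H$ be a separable complex Hilbert space and let $L(H)$ be the algebra of bounded linear operators on $H$. Let $A_W$ be the Wiener algebra of functions $f(t)=\sum_{n\ge0}f_nt^n$ on $\overline{\mathbb D}=\{|t|\le1\}$ with $\sum_n|f_n|<\infty$. For $T\in L(H)$ with spectrum $\sigma(T)\subset\overline{\mathbb D}$, let $\mathcal A_{T,\mathbb R}$ (respectively $\mathcal A^0_{T,\mathbb R}$) be the set of all $f\in A_W$ with real Taylor coefficients $f_n$ for which the series $\sum_{n\ge0}|f_n|T^{*n}T^n$ converges in the strong operator topology (respectively in the operator norm). For a function $f(t)=\sum_{n\ge0}f_nt^n$ analytic in $\mathbb D=\{|t|<1\}$ put $f(T^*,T):=\sum_{n\ge0}f_nT^{*n}T^n$ whenever this series converges in the strong operator topology. For $a>0$, an operator $T\in L(H)$ is called an $a$-contraction if $f(T^*,T)$ exists and $f(T^*,T)\ge0$ for $f(t)=(1-t)^a$ (principal branch). **Corollary 1.2.** Let $\hat T\in L(H)$ with $\sigma(\hat T)\subset\overline{\mathbb D}$. Suppose that $\gamma(t)=(1-t)^a\,\tilde\gamma(t)$ in $\mathbb D$ for some $a>0$, where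 $(1-t)^a\in\mathcal A_{\hat T,\mathbb R}$, and $\tilde\gamma\in\mathcal A^0_{\hat T,\mathbb R}$ is positive on the interval $[0,1]$. (Then the series defining $\gamma(\hat T^*,\hat T)$ converges in the strong operator topology.) If $\gamma(\hat T^*,\hat T)\ge0$, then $\hat T$ is similar to an $a$-contraction $T\in L(H)$, that is, there is a bounded invertible operator $B$ on $H$ such that $B\hat TB^{-1}$ is an $a$-contraction. -/

import Mathlib

open Filter Topology

/-- The `n`-th Taylor coefficient at the origin of a function of a complex variable. -/
noncomputable def taylorCoeff (f : ℂ → ℂ) (n : ℕ) : ℂ :=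
  iteratedDeriv n f 0 / (n.factorial : ℂ)

/-- Membership in the Wiener algebra `A_W`: the Taylor coefficients are absolutely summable and
the Taylor series represents `f` on the closed unit disc. Values of `f` outside the closed unit
disc play no role. -/
structure MemWiener (f : ℂ → ℂ) : Prop where
  summable : Summable fun n => ‖taylorCoeff f n‖
  hasSum : ∀ t : ℂ, ‖t‖ ≤ 1 → HasSum (fun n => taylorCoeff f n * t ^ n) (f t)

/-- The Taylor coefficients of `f` are real. -/
def HasRealCoeffs (f : ℂ → ℂ) : Prop :=
  ∀ n, (taylorCoeff f n).im = 0

section Operators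

variable {H : Type*} [NormedAddCommGroup H] [InnerProductSpace ℂ H] [CompleteSpace H]

/-- The partial sum `∑_{n < N} c n • T*ⁿ Tⁿ`. -/
noncomputable def hereditaryPartialSum (c : ℕ → ℂ) (T : H →L[ℂ] H) (N : ℕ) : H →L[ℂ] H :=
  ∑ n ∈ Finset.range N, c n • ((ContinuousLinearMap.adjoint T) ^ n * T ^ n)

/-- The series `∑ c n • T*ⁿ Tⁿ` converges to `S` in the strong operator topology. -/
def ConvergesSOT (c : ℕ → ℂ) (T S : H →L[ℂ] H) : Prop :=
  ∀ x : H, Tendsto (fun N => hereditaryPartialSum c T N x) atTop (𝓝 (S x))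

/-- The series `∑ c n • T*ⁿ Tⁿ` converges to `S` in the operator norm. -/
def ConvergesNorm (c : ℕ → ℂ) (T S : H →L[ℂ] H) : Prop :=
  Tendsto (fun N => hereditaryPartialSum c T N) atTop (𝓝 S)

/-- `f ∈ 𝒜_T`: `f ∈ A_W` and `∑ |f_n| T*ⁿ Tⁿ` converges in the strong operator topology. -/
def MemA (T : H →L[ℂ] H) (f : ℂ → ℂ) : Prop :=
  MemWiener f ∧ ∃ S : H →L[ℂ] H, ConvergesSOT (fun n => (‖taylorCoeff f n‖ : ℂ)) T S

/-- `f ∈ 𝒜_T⁰`: `f ∈ A_W` and `∑ |f_n| T*ⁿ Tⁿ` converges in the operator norm. -/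
def MemA0 (T : H →L[ℂ] H) (f : ℂ → ℂ) : Prop :=
  MemWiener f ∧ ∃ S : H →L[ℂ] H, ConvergesNorm (fun n => (‖taylorCoeff f n‖ : ℂ)) T S

/-- `f ∈ 𝒜_{T,ℝ}`. -/
def MemAReal (T : H →L[ℂ] H) (f : ℂ → ℂ) : Prop :=
  MemA T f ∧ HasRealCoeffs f

/-- `f ∈ 𝒜⁰_{T,ℝ}`. -/
def MemA0Real (T : H →L[ℂ] H) (f : ℂ → ℂ) : Prop :=
  MemA0 T f ∧ HasRealCoeffs f

/-- The series defining `f(T*, T)` converges in the strong operator topology. -/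
def HereditaryConverges (f : ℂ → ℂ) (T : H →L[ℂ] H) : Prop :=
  ∃ S : H →L[ℂ] H, ConvergesSOT (taylorCoeff f) T S

open Classical in
/-- `f(T*, T) = ∑ f_n T*ⁿ Tⁿ`, the sum being taken in the strong operator topology
(the default value `0` is used if the series does not converge). -/
noncomputable def hereditary (f : ℂ → ℂ) (T : H →L[ℂ] H) : H →L[ℂ] H :=
  if h : HereditaryConverges f T then h.choose else 0

/-- The function `t ↦ (1 - t)ᵃ` (principal branch, which is analytic on the unit disc). -/
noncomputable def oneSubPow (a : ℝ) : ℂ → ℂ :=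
  fun t => (1 - t) ^ (a : ℂ)

/-- `T` is an `a`-contraction: `(1 - t)ᵃ(T*, T)` exists and is a nonnegative operator. -/
def IsAContraction (a : ℝ) (T : H →L[ℂ] H) : Prop :=
  HereditaryConverges (oneSubPow a) T ∧ (hereditary (oneSubPow a) T).IsPositive

/-- Similarity of operators: `T = B T' B⁻¹` for a bounded invertible operator `B`. -/
def IsSimilarOp (T' T : H →L[ℂ] H) : Prop :=
  ∃ B : H ≃L[ℂ] H,
    T = (B : H →L[ℂ] H) ∘L T' ∘L (B.symm : H →L[ℂ] H)

end Operators

/-! ### Multiplying a polynomial by a negative binomial series -/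

/-! Write `α`, `β` for the coefficients of `(1 - t)ᵃ` and `γt`, and `φ x = ∑ β m ‖T̂ᵐ x‖²` for the
form of `γt(T̂*, T̂)`. If `φ` were coercive it would be the square of an equivalent Hilbert norm,
and in that norm the form of `(1 - t)ᵃ` would be `∑ α n φ(T̂ⁿ x)`, which is the form of `γ` and
hence nonnegative.

In general `φ` need not be coercive, so it is averaged: `ψ x = ∑ g k φ(T̂ᵏ x)` with `g k ≥ 0`. Since
all forms commute with shifts along the orbit, `∑ α n ψ(T̂ⁿ x)` is the `g`-weighted sum of the
values of the `γ`-form at `T̂ᵏ x`, so it stays nonnegative (`tsum_mul_weights_nonneg`).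

It remains to choose `g` with `ψ` coercive (`exists_weights_coercive`). Norm convergence and
positivity on `[0, 1]` bound `φ` below by the form of a polynomial `q` still positive on `[0, 1]`.
In the spirit of Pólya's theorem, `q(t) (1 - t / ρ)^(-(K + 1))` has nonnegative coefficients for `ρ
> 1` near `1` and `K` large (`exists_negBinomial_mul_coeff_nonneg`). Taking `g` to be the
coefficients of the second factor gives `ψ x ≥ q 0 * g 0 * ‖x‖²`; as `ρ > 1`, the spectral
hypothesis makes `∑ g k ‖T̂ᵏ‖²` finite. The square root of the operator of `ψ` implements the
similarity (`exists_equiv_norm_sq_eq`). -/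

lemma choose_mul_descFactorial_add (m j K : ℕ) :
    (m + K).choose K * (m + j + K).descFactorial j
      = (m + j + K).choose K * (m + j).descFactorial j := by
  have h1 : (m + K).factorial * (m + j + K).descFactorial j = (m + j + K).factorial := by
    have := Nat.factorial_mul_descFactorial (n := m + j + K) (k := j) (by omega)
    rwa [show m + j + K - j = m + K by omega] at this
  have h2 : m.factorial * (m + j).descFactorial j = (m + j).factorial := by
    have := Nat.factorial_mul_descFactorial (n := m + j) (k := j) (by omega)
    rwa [show m + j - j = m by omega] at this
  have h3 := Nat.add_choose_mul_factorial_mul_factorial m K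
  have h4 := Nat.add_choose_mul_factorial_mul_factorial (m + j) K
  apply Nat.eq_of_mul_eq_mul_right (Nat.mul_pos m.factorial_pos K.factorial_pos)
  calc (m + K).choose K * (m + j + K).descFactorial j * (m.factorial * K.factorial)
      = ((m + K).choose K * m.factorial * K.factorial) * (m + j + K).descFactorial j := by ring
    _ = (m + j + K).choose K * (m + j).factorial * K.factorial := by rw [h3, h1, h4]
    _ = _ := by rw [← h2]; ring

/-- Controls one factor of a quotient of falling factorials. The point is uniformity in `n`: the
bound depends on `d` and `K` only and vanishes as `K → ∞`. -/
lemma abs_natSub_div_sub_div_le (n K j d : ℕ) (hj : j ≤ d) (hd : d < K) :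
    |((n - j : ℕ) : ℝ) / ((n + K - j : ℕ) : ℝ) - (n : ℝ) / ((n + K : ℕ) : ℝ)|
      ≤ (d : ℝ) / ((K - d : ℕ) : ℝ) := by
  have hKd : (0 : ℝ) < ((K - d : ℕ) : ℝ) := by exact_mod_cast Nat.sub_pos_of_lt hd
  have hM : (0 : ℝ) < ((n + K : ℕ) : ℝ) := by exact_mod_cast (by omega : 0 < n + K)
  have hMj : (0 : ℝ) < ((n + K - j : ℕ) : ℝ) := by exact_mod_cast (by omega : 0 < n + K - j)
  have hle : ((K - d : ℕ) : ℝ) ≤ ((n + K - j : ℕ) : ℝ) := by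
    exact_mod_cast (by omega : K - d ≤ n + K - j)
  have hle' : ((K - d : ℕ) : ℝ) ≤ ((n + K : ℕ) : ℝ) := by
    exact_mod_cast (by omega : K - d ≤ n + K)
  rcases le_or_gt j n with h | h
  · have key : ((n - j : ℕ) : ℝ) / ((n + K - j : ℕ) : ℝ) - (n : ℝ) / ((n + K : ℕ) : ℝ)
        = -((j : ℝ) / ((n + K - j : ℕ) : ℝ) * ((K : ℝ) / ((n + K : ℕ) : ℝ))) := by
      rw [div_sub_div _ _ hMj.ne' hM.ne', div_mul_div_comm, ← neg_div]
      congr 1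
      rw [Nat.cast_sub h, Nat.cast_sub (by omega : j ≤ n + K)]
      push_cast
      ring
    rw [key, abs_neg, abs_of_nonneg (by positivity)]
    have h1 : (K : ℝ) / ((n + K : ℕ) : ℝ) ≤ 1 := by
      rw [div_le_one hM]; exact_mod_cast Nat.le_add_left K n
    calc (j : ℝ) / ((n + K - j : ℕ) : ℝ) * ((K : ℝ) / ((n + K : ℕ) : ℝ))
        ≤ (j : ℝ) / ((n + K - j : ℕ) : ℝ) * 1 := by gcongr
      _ ≤ _ := by rw [mul_one]; gcongr
  -- Here `n < j`, so truncated subtraction makes the first quotient zero, and `n ≤ d` bounds the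
  -- second.
  · rw [Nat.sub_eq_zero_of_le h.le, Nat.cast_zero, zero_div, zero_sub, abs_neg,
      abs_of_nonneg (by positivity)]
    gcongr
    omega

/-- Both sides are products of `j` factors in `[0, 1]`, so the errors of the single factors add up.
-/
lemma abs_descFactorial_ratio_sub_pow_le (n K d : ℕ) (hd : d < K) (j : ℕ) (hj : j ≤ d) :
    |(n.descFactorial j : ℝ) / ((n + K).descFactorial j : ℝ)
        - ((n : ℝ) / ((n + K : ℕ) : ℝ)) ^ j| ≤ j * ((d : ℝ) / ((K - d : ℕ) : ℝ)) := by
  induction j with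
  | zero => simp
  | succ j ih =>
    have ih := ih (by omega)
    have h1 := abs_natSub_div_sub_div_le n K j d (by omega) hd
    set s : ℝ := (n : ℝ) / ((n + K : ℕ) : ℝ)
    set e : ℝ := (d : ℝ) / ((K - d : ℕ) : ℝ)
    have hs0 : 0 ≤ s := by positivity
    have hs1 : s ≤ 1 := div_le_one_of_le₀ (by exact_mod_cast Nat.le_add_right n K) (by positivity)
    rw [Nat.descFactorial_succ, Nat.descFactorial_succ, Nat.cast_mul, Nat.cast_mul,
      mul_div_mul_comm]
    set u : ℝ := ((n - j : ℕ) : ℝ) / ((n + K - j : ℕ) : ℝ)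
    set x : ℝ := (n.descFactorial j : ℝ) / ((n + K).descFactorial j : ℝ)
    have hu0 : 0 ≤ u := by positivity
    have hu1 : u ≤ 1 := div_le_one_of_le₀
      (by exact_mod_cast Nat.sub_le_sub_right (Nat.le_add_right n K) j) (by positivity)
    have hsj0 : 0 ≤ s ^ j := by positivity
    have hsj1 : s ^ j ≤ 1 := pow_le_one₀ hs0 hs1
    calc |u * x - s ^ (j + 1)| = |u * (x - s ^ j) + s ^ j * (u - s)| := by congr 1; ring
      _ ≤ u * |x - s ^ j| + s ^ j * |u - s| := by
        refine (abs_add_le _ _).trans ?_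
        rw [abs_mul, abs_mul, abs_of_nonneg hu0, abs_of_nonneg hsj0]
      _ ≤ 1 * (j * e) + 1 * e := by gcongr
      _ = _ := by push_cast; ring

/-- A polynomial which is positive on `[0, 1]` acquires nonnegative Taylor coefficients after
division by a suitable power `(1 - t / ρ) ^ (K + 1)` with `ρ > 1`. -/
theorem exists_negBinomial_mul_coeff_nonneg (d : ℕ) (q : ℕ → ℝ)
    (hq : ∀ t ∈ Set.Icc (0 : ℝ) 1, 0 < ∑ j ∈ Finset.range d, q j * t ^ j) :
    ∃ ρ : ℝ, 1 < ρ ∧ ∃ K : ℕ, ∀ n : ℕ, 0 ≤ ∑ j ∈ Finset.range d,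
      if j ≤ n then q j * (((n - j + K).choose K : ℝ) * ρ⁻¹ ^ (n - j)) else 0 := by
  obtain ⟨t₀, ht₀, hmin⟩ := isCompact_Icc.exists_isMinOn (Set.nonempty_Icc.2 zero_le_one)
    (f := fun t : ℝ => ∑ j ∈ Finset.range d, q j * t ^ j) (by fun_prop)
  set δ := ∑ j ∈ Finset.range d, q j * t₀ ^ j
  have hδ0 : 0 < δ := hq t₀ ht₀
  have hmin' : ∀ t ∈ Set.Icc (0 : ℝ) 1, δ ≤ ∑ j ∈ Finset.range d, q j * t ^ j := fun t ht => hmin ht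
  -- The minimum `δ` is an error budget: half pays for replacing `ρ ^ j` by `1`, half for replacing
  -- the falling factorial quotients by powers of `s`.
  obtain ⟨ρ, hρ, hρ1⟩ : ∃ ρ : ℝ, ∑ j ∈ Finset.range d, |q j| * |ρ ^ j - 1| < δ / 2 ∧ 1 < ρ := by
    have hc : Tendsto (fun ρ : ℝ => ∑ j ∈ Finset.range d, |q j| * |ρ ^ j - 1|) (𝓝[>] 1) (𝓝 0) := by
      have : Continuous (fun ρ : ℝ => ∑ j ∈ Finset.range d, |q j| * |ρ ^ j - 1|) := by fun_prop
      simpa using (this.tendsto 1).mono_left nhdsWithin_le_nhds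
    exact ((hc.eventually_lt_const (half_pos hδ0)).and self_mem_nhdsWithin).exists
  have hρ0 : 0 < ρ := by linarith
  obtain ⟨K, hK, hdK⟩ : ∃ K : ℕ, ∑ j ∈ Finset.range d,
      |q j| * ρ ^ j * (j * ((d : ℝ) / ((K - d : ℕ) : ℝ))) < δ / 2 ∧ d < K := by
    have h1 : Tendsto (fun K : ℕ => (d : ℝ) / ((K - d : ℕ) : ℝ)) atTop (𝓝 0) :=
      (tendsto_const_div_atTop_nhds_zero_nat (d : ℝ)).comp (tendsto_sub_atTop_nat d)
    have h2 : Tendsto (fun K : ℕ => ∑ j ∈ Finset.range d,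
        |q j| * ρ ^ j * (j * ((d : ℝ) / ((K - d : ℕ) : ℝ)))) atTop (𝓝 0) := by
      have := tendsto_finsetSum (Finset.range d)
        (fun j _ => (h1.const_mul (j : ℝ)).const_mul (|q j| * ρ ^ j))
      simpa using this
    exact ((h2.eventually_lt_const (half_pos hδ0)).and (eventually_gt_atTop d)).exists
  refine ⟨ρ, hρ1, K, fun n => ?_⟩
  -- Up to a positive factor, the `n`-th coefficient is nearly the value of the polynomial at this
  -- point of `[0, 1]`.
  set s : ℝ := (n : ℝ) / ((n + K : ℕ) : ℝ)
  have hs0 : 0 ≤ s := by positivity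
  have hs1 : s ≤ 1 := div_le_one_of_le₀ (by exact_mod_cast Nat.le_add_right n K) (by positivity)
  let x : ℕ → ℝ := fun j => (n.descFactorial j : ℝ) / ((n + K).descFactorial j : ℝ)
  have hterm : ∀ j ∈ Finset.range d,
      (if j ≤ n then q j * (((n - j + K).choose K : ℝ) * ρ⁻¹ ^ (n - j)) else 0)
        = ((n + K).choose K * ρ⁻¹ ^ n) * (q j * (ρ ^ j * x j)) := by
    intro j hj
    split_ifs with h
    · obtain ⟨m, rfl⟩ := Nat.exists_eq_add_of_le' h
      have hne : ((m + j + K).descFactorial j : ℝ) ≠ 0 := by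
        have : 0 < (m + j + K).descFactorial j := Nat.descFactorial_pos.2 (by omega)
        exact_mod_cast this.ne'
      have h1 : ((m + K).choose K : ℝ) = (m + j + K).choose K * x j := by
        rw [mul_div_assoc', eq_div_iff hne]
        exact_mod_cast choose_mul_descFactorial_add m j K
      have h2 : ρ⁻¹ ^ (m + j) * ρ ^ j = ρ⁻¹ ^ m := by
        rw [pow_add, mul_assoc, ← mul_pow, inv_mul_cancel₀ hρ0.ne', one_pow, mul_one]
      rw [Nat.add_sub_cancel, h1, ← h2]
      ring
    -- The falling factorial vanishes for `j > n`, so the truncation `j ≤ n` is automatic.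
    · have : x j = 0 := by simp [x, Nat.descFactorial_of_lt (not_le.1 h)]
      rw [this]; ring
  rw [Finset.sum_congr rfl hterm, ← Finset.mul_sum]
  refine mul_nonneg (by positivity) ?_
  have hdiff : |∑ j ∈ Finset.range d, q j * (ρ ^ j * x j) - ∑ j ∈ Finset.range d, q j * s ^ j|
      ≤ ∑ j ∈ Finset.range d, |q j| * ρ ^ j * (j * ((d : ℝ) / ((K - d : ℕ) : ℝ)))
        + ∑ j ∈ Finset.range d, |q j| * |ρ ^ j - 1| := by
    rw [← Finset.sum_sub_distrib, ← Finset.sum_add_distrib]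
    refine (Finset.abs_sum_le_sum_abs _ _).trans (Finset.sum_le_sum fun j hj => ?_)
    have hx := abs_descFactorial_ratio_sub_pow_le n K d hdK j (Finset.mem_range.1 hj).le
    have hsj0 : 0 ≤ s ^ j := by positivity
    have hsj1 : s ^ j ≤ 1 := pow_le_one₀ hs0 hs1
    calc |q j * (ρ ^ j * x j) - q j * s ^ j|
        = |q j * ρ ^ j * (x j - s ^ j) + q j * ((ρ ^ j - 1) * s ^ j)| := by congr 1; ring
      _ ≤ |q j| * ρ ^ j * |x j - s ^ j| + |q j| * (|ρ ^ j - 1| * s ^ j) := by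
        refine (abs_add_le _ _).trans ?_
        rw [abs_mul, abs_mul, abs_mul, abs_mul, abs_of_nonneg hsj0,
          abs_of_nonneg (by positivity : 0 ≤ ρ ^ j)]
      _ ≤ |q j| * ρ ^ j * (j * ((d : ℝ) / ((K - d : ℕ) : ℝ))) + |q j| * (|ρ ^ j - 1| * 1) := by
        gcongr
      _ = _ := by rw [mul_one]
  have := abs_le.1 hdiff
  have := hmin' s ⟨hs0, hs1⟩
  linarith

/-! ### Taylor coefficients of functions of the Wiener algebra -/

lemma MemWiener.analyticAt_zero {f : ℂ → ℂ} (hf : MemWiener f) : AnalyticAt ℂ f 0 := by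
  have hd : DifferentiableOn ℂ (fun t : ℂ => ∑' n, taylorCoeff f n * t ^ n)
      (Metric.ball 0 1) := by
    refine Complex.differentiableOn_tsum_of_summable_norm hf.summable
      (fun n => by fun_prop) Metric.isOpen_ball fun n t ht => ?_
    rw [norm_mul, norm_pow]
    exact mul_le_of_le_one_right (norm_nonneg _)
      (pow_le_one₀ (norm_nonneg _) (mem_ball_zero_iff.1 ht).le)
  have hd' : DifferentiableOn ℂ f (Metric.ball 0 1) := hd.congr fun t ht =>
    (hf.hasSum t (mem_ball_zero_iff.1 ht).le).tsum_eq.symm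
  exact hd'.analyticAt (Metric.ball_mem_nhds 0 one_pos)

/-- The Taylor coefficients of a product are given by the Cauchy product. -/
lemma taylorCoeff_mul {f g : ℂ → ℂ} (hf : AnalyticAt ℂ f 0) (hg : AnalyticAt ℂ g 0) (n : ℕ) :
    taylorCoeff (fun t => f t * g t) n
      = ∑ p ∈ Finset.HasAntidiagonal.antidiagonal n, taylorCoeff f p.1 * taylorCoeff g p.2 := by
  unfold taylorCoeff
  rw [iteratedDeriv_fun_mul hf.contDiffAt hg.contDiffAt,
    Finset.Nat.sum_antidiagonal_eq_sum_range_succ_mk, Finset.sum_div]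
  refine Finset.sum_congr rfl fun i hi => ?_
  have hi : i ≤ n := Nat.lt_succ_iff.1 (Finset.mem_range.1 hi)
  rw [Nat.cast_choose ℂ hi]
  have h1 : (n.factorial : ℂ) ≠ 0 := by exact_mod_cast n.factorial_ne_zero
  have h2 : (i.factorial : ℂ) ≠ 0 := by exact_mod_cast i.factorial_ne_zero
  have h3 : ((n - i).factorial : ℂ) ≠ 0 := by exact_mod_cast (n - i).factorial_ne_zero
  field_simp

lemma HasRealCoeffs.ofReal_re {f : ℂ → ℂ} (hf : HasRealCoeffs f) (n : ℕ) :
    (((taylorCoeff f n).re : ℝ) : ℂ) = taylorCoeff f n :=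
  Complex.ext rfl (by simpa using (hf n).symm)

lemma HasRealCoeffs.norm_taylorCoeff {f : ℂ → ℂ} (hf : HasRealCoeffs f) (n : ℕ) :
    ‖taylorCoeff f n‖ = |(taylorCoeff f n).re| := by
  rw [← hf.ofReal_re n, Complex.norm_real, Real.norm_eq_abs, Complex.ofReal_re]

/-- The partial sums of an absolutely convergent power series which is positive on `[0, 1]` are
eventually bounded below on `[0, 1]` by a positive constant. -/
lemma exists_eventually_le_partialSum {c : ℕ → ℝ} (hc : Summable fun n => |c n|)
    (hpos : ∀ t ∈ Set.Icc (0 : ℝ) 1, 0 < ∑' n, c n * t ^ n) :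
    ∃ δ : ℝ, 0 < δ ∧ ∀ᶠ N in atTop, ∀ t ∈ Set.Icc (0 : ℝ) 1,
      δ < ∑ n ∈ Finset.range N, c n * t ^ n := by
  have hb : ∀ (n : ℕ) (t : ℝ), t ∈ Set.Icc (0 : ℝ) 1 → ‖c n * t ^ n‖ ≤ |c n| := by
    intro n t ht
    rw [norm_mul, norm_pow, Real.norm_eq_abs, Real.norm_eq_abs, abs_of_nonneg ht.1]
    exact mul_le_of_le_one_right (abs_nonneg _) (pow_le_one₀ ht.1 ht.2)
  have hcont : ContinuousOn (fun t : ℝ => ∑' n, c n * t ^ n) (Set.Icc 0 1) :=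
    continuousOn_tsum (fun n => by fun_prop) hc hb
  obtain ⟨t₀, ht₀, hmin⟩ :=
    isCompact_Icc.exists_isMinOn (Set.nonempty_Icc.2 zero_le_one) hcont
  have h0 := hpos t₀ ht₀
  refine ⟨(∑' n, c n * t₀ ^ n) / 2, half_pos h0, ?_⟩
  have hu := tendstoUniformlyOn_tsum_nat hc hb
  filter_upwards [Metric.tendstoUniformlyOn_iff.1 hu _ (half_pos h0)] with N hN t ht
  have h1 := (abs_lt.1 (hN t ht)).2
  have h2 : ∑' n, c n * t₀ ^ n ≤ ∑' n, c n * t ^ n := hmin ht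
  linarith

/-! ### Shifted sums -/

section Shift

variable {α β u : ℕ → ℝ}

/-- Summation of a Cauchy product against a sequence. -/
lemma hasSum_cauchyProduct_mul
    (h : Summable fun p : ℕ × ℕ => α p.1 * (β p.2 * u (p.1 + p.2))) :
    HasSum (fun N => (∑ p ∈ Finset.HasAntidiagonal.antidiagonal N, α p.1 * β p.2) * u N)
      (∑' n, α n * ∑' m, β m * u (n + m)) := by
  have h1 : HasSum (fun p : ℕ × ℕ => α p.1 * (β p.2 * u (p.1 + p.2)))
      (∑' n, α n * ∑' m, β m * u (n + m)) := by
    have := h.hasSum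
    rw [h.tsum_prod] at this
    simpa only [tsum_mul_left] using this
  have h2 := (Finset.HasAntidiagonal.sigmaAntidiagonalEquivProd (A := ℕ)).hasSum_iff.2 h1
  have h3 := h2.sigma fun N => hasSum_fintype _
  convert h3 using 2 with N
  rw [Finset.sum_mul, ← Finset.sum_coe_sort]
  refine Finset.sum_congr rfl fun p _ => ?_
  have : (p : ℕ × ℕ).1 + (p : ℕ × ℕ).2 = N := Finset.HasAntidiagonal.mem_antidiagonal.1 p.2
  simp [this, mul_assoc]

/-- A two-variable summability criterion by iterated partial sums. -/
lemma summable_mul_shift {C : ℝ} {v : ℕ → ℝ} (hu : ∀ n, 0 ≤ u n)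
    (hα : ∀ m N, ∑ n ∈ Finset.range N, |α n| * u (n + m) ≤ C * v m)
    (hβ : Summable fun m => |β m| * v m) :
    Summable fun p : ℕ × ℕ => α p.1 * (β p.2 * u (p.1 + p.2)) := by
  rw [← summable_abs_iff]
  simp only [abs_mul, abs_of_nonneg (hu _)]
  -- The hypothesis on `α` controls sums over `n` at fixed shift `m`, so `n` must become the inner
  -- variable.
  rw [← (Equiv.prodComm ℕ ℕ).summable_iff]
  have hs : ∀ m, Summable fun n => |α n| * u (n + m) := fun m =>
    summable_of_sum_range_le (fun n => mul_nonneg (abs_nonneg _) (hu _)) (hα m)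
  refine (summable_prod_of_nonneg fun p => ?_).2 ⟨fun m => ?_, ?_⟩
  · exact mul_nonneg (abs_nonneg _) (mul_nonneg (abs_nonneg _) (hu _))
  · refine ((hs m).mul_left |β m|).congr fun n => ?_
    simp only [Function.comp, Equiv.prodComm_apply, Prod.swap]
    ring
  · refine Summable.of_nonneg_of_le (fun m => tsum_nonneg fun n => ?_) (fun m => ?_)
      (hβ.mul_left C)
    · exact mul_nonneg (abs_nonneg _) (mul_nonneg (abs_nonneg _) (hu _))
    · calc ∑' n, ((fun p : ℕ × ℕ => |α p.1| * (|β p.2| * u (p.1 + p.2)))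
            ∘ (Equiv.prodComm ℕ ℕ)) (m, n) = ∑' n, |β m| * (|α n| * u (n + m)) := by
            refine tsum_congr fun n => ?_
            simp only [Function.comp, Equiv.prodComm_apply, Prod.swap]
            ring
        _ = |β m| * ∑' n, |α n| * u (n + m) := tsum_mul_left
        _ ≤ |β m| * (C * v m) := by
            gcongr
            exact Real.tsum_le_of_sum_range_le (fun n => mul_nonneg (abs_nonneg _) (hu _)) (hα m)
        _ = _ := by ring

/-- If the Cauchy product of a polynomial `q` with a nonnegative sequence `g` is nonnegative, then
summing `g` against the shifts of `q` yields at least the contribution of the constant term. -/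
lemma mul_le_tsum_mul_polynomial_shift {g q : ℕ → ℝ} {d : ℕ} (hu : ∀ n, 0 ≤ u n)
    (hd : 0 < d)
    (hsum : ∀ j, Summable fun k => g k * u (k + j))
    (hpos : ∀ n, 0 ≤ ∑ j ∈ Finset.range d, if j ≤ n then q j * g (n - j) else 0) :
    q 0 * g 0 * u 0 ≤ ∑' k, g k * ∑ j ∈ Finset.range d, q j * u (k + j) := by
  have h1 : ∀ j, HasSum (fun n => if j ≤ n then q j * g (n - j) * u n else 0)
      (∑' k, q j * (g k * u (k + j))) := by
    intro j
    have h := ((hsum j).mul_left (q j)).hasSum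
    refine ((add_left_injective j).hasSum_iff (fun n hn => ?_)).1 (h.congr_fun ?_)
    · rw [if_neg]
      intro hjn
      exact hn ⟨n - j, Nat.sub_add_cancel hjn⟩
    · intro k
      simp [mul_assoc]
  have h2 := hasSum_sum (s := Finset.range d) fun j _ => h1 j
  have h3 : ∑ j ∈ Finset.range d, ∑' k, q j * (g k * u (k + j))
      = ∑' k, g k * ∑ j ∈ Finset.range d, q j * u (k + j) := by
    rw [← Summable.tsum_finsetSum fun j _ => (hsum j).mul_left (q j)]
    refine tsum_congr fun k => ?_
    rw [Finset.mul_sum]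
    exact Finset.sum_congr rfl fun j _ => by ring
  rw [h3] at h2
  have h4 : ∀ n, ∑ j ∈ Finset.range d, (if j ≤ n then q j * g (n - j) * u n else 0)
      = (∑ j ∈ Finset.range d, if j ≤ n then q j * g (n - j) else 0) * u n := by
    intro n
    rw [Finset.sum_mul]
    exact Finset.sum_congr rfl fun j _ => by split_ifs <;> simp
  simp only [h4] at h2
  -- All terms are nonnegative; only the one at `n = 0` is kept.
  have h5 := le_hasSum h2 0 fun n _ => mul_nonneg (hpos n) (hu n)
  refine le_of_eq_of_le ?_ h5
  congr 1
  rw [Finset.sum_eq_single_of_mem 0 (Finset.mem_range.2 hd)]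
  · simp
  · intro j _ hj
    simp [hj]

end Shift

/-! ### Hereditary series and quadratic forms -/

section Forms

variable {H : Type*} [NormedAddCommGroup H] [InnerProductSpace ℂ H]

/-- The quadratic forms of the partial sums of `∑ |c n| T*ⁿ Tⁿ` are bounded by `C ‖x‖²`. -/
def HereditaryBounded (c : ℕ → ℝ) (T : H →L[ℂ] H) (C : ℝ) : Prop :=
  ∀ (x : H) (N : ℕ), ∑ n ∈ Finset.range N, |c n| * ‖(T ^ n) x‖ ^ 2 ≤ C * ‖x‖ ^ 2

lemma HereditaryBounded.summable {c : ℕ → ℝ} {T : H →L[ℂ] H} {C : ℝ}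
    (h : HereditaryBounded c T C) (x : H) : Summable fun n => |c n| * ‖(T ^ n) x‖ ^ 2 :=
  summable_of_sum_range_le (fun n => by positivity) (h x)

lemma HereditaryBounded.summable_mul {c : ℕ → ℝ} {T : H →L[ℂ] H} {C : ℝ}
    (h : HereditaryBounded c T C) (x : H) : Summable fun n => c n * ‖(T ^ n) x‖ ^ 2 := by
  refine Summable.of_norm ((h.summable x).congr fun n => ?_)
  rw [norm_mul, Real.norm_eq_abs, Real.norm_of_nonneg (by positivity)]

variable [CompleteSpace H]

lemma inner_adjoint_pow_mul_pow (T : H →L[ℂ] H) (n : ℕ) (x y : H) :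
    inner ℂ (((ContinuousLinearMap.adjoint T) ^ n * T ^ n) x) y = inner ℂ ((T ^ n) x) ((T ^ n) y) := by
  rw [← ContinuousLinearMap.star_eq_adjoint, ← star_pow, ContinuousLinearMap.star_eq_adjoint,
    mul_apply_eq_comp, ContinuousLinearMap.adjoint_inner_left]

lemma inner_hereditaryPartialSum (c : ℕ → ℝ) (T : H →L[ℂ] H) (N : ℕ) (x y : H) :
    inner ℂ (hereditaryPartialSum (fun n => (c n : ℂ)) T N x) y
      = ∑ n ∈ Finset.range N, (c n : ℂ) * inner ℂ ((T ^ n) x) ((T ^ n) y) := by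
  rw [hereditaryPartialSum, sum_apply, sum_inner]
  refine Finset.sum_congr rfl fun n _ => ?_
  rw [smul_apply, inner_smul_left, Complex.conj_ofReal,
    inner_adjoint_pow_mul_pow]

lemma inner_hereditaryPartialSum_self (c : ℕ → ℝ) (T : H →L[ℂ] H) (N : ℕ) (x : H) :
    inner ℂ (hereditaryPartialSum (fun n => (c n : ℂ)) T N x) x
      = ((∑ n ∈ Finset.range N, c n * ‖(T ^ n) x‖ ^ 2 : ℝ) : ℂ) := by
  rw [inner_hereditaryPartialSum, Complex.ofReal_sum]
  refine Finset.sum_congr rfl fun n _ => ?_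
  rw [inner_self_eq_norm_sq_to_K]
  push_cast
  rfl

lemma ConvergesSOT.tendsto_inner {c : ℕ → ℝ} {T S : H →L[ℂ] H}
    (h : ConvergesSOT (fun n => (c n : ℂ)) T S) (x : H) :
    Tendsto (fun N => ((∑ n ∈ Finset.range N, c n * ‖(T ^ n) x‖ ^ 2 : ℝ) : ℂ)) atTop
      (𝓝 (inner ℂ (S x) x)) := by
  simp only [← inner_hereditaryPartialSum_self]
  exact (h x).inner tendsto_const_nhds

lemma HereditaryBounded.inner_eq_tsum {c : ℕ → ℝ} {T S : H →L[ℂ] H} {C : ℝ}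
    (h : HereditaryBounded c T C) (hS : ConvergesSOT (fun n => (c n : ℂ)) T S) (x : H) :
    inner ℂ (S x) x = ((∑' n, c n * ‖(T ^ n) x‖ ^ 2 : ℝ) : ℂ) :=
  tendsto_nhds_unique (hS.tendsto_inner x)
    ((Complex.continuous_ofReal.tendsto _).comp (h.summable_mul x).hasSum.tendsto_sum_nat)

lemma HereditaryBounded.isPositive_iff {c : ℕ → ℝ} {T S : H →L[ℂ] H} {C : ℝ}
    (h : HereditaryBounded c T C) (hS : ConvergesSOT (fun n => (c n : ℂ)) T S) :
    S.IsPositive ↔ ∀ x, 0 ≤ ∑' n, c n * ‖(T ^ n) x‖ ^ 2 := by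
  rw [ContinuousLinearMap.isPositive_iff_complex]
  refine forall_congr' fun x => ?_
  rw [h.inner_eq_tsum hS x]
  simp

/-- Strong convergence of `∑ |c n| T*ⁿ Tⁿ` bounds the associated quadratic forms. -/
lemma ConvergesSOT.hereditaryBounded {c : ℕ → ℝ} {T S : H →L[ℂ] H}
    (h : ConvergesSOT (fun n => ((|c n| : ℝ) : ℂ)) T S) : HereditaryBounded c T ‖S‖ := by
  intro x N
  have ht := (Complex.continuous_re.tendsto _).comp (h.tendsto_inner x)
  have hm : Monotone fun N => ∑ n ∈ Finset.range N, |c n| * ‖(T ^ n) x‖ ^ 2 :=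
    monotone_nat_of_le_succ fun n => by
      rw [Finset.sum_range_succ]
      exact le_add_of_nonneg_right (by positivity)
  refine (hm.ge_of_tendsto ht N).trans ((Complex.re_le_norm _).trans ?_)
  refine (norm_inner_le_norm _ _).trans ?_
  calc ‖S x‖ * ‖x‖ ≤ ‖S‖ * ‖x‖ * ‖x‖ := by gcongr; exact S.le_opNorm x
    _ = _ := by ring

/-- If the quadratic forms of `∑ |c n| T*ⁿ Tⁿ` are bounded, then `∑ c n T*ⁿ Tⁿ` converges in the
strong operator topology. -/
theorem HereditaryBounded.exists_convergesSOT {c : ℕ → ℝ} {T : H →L[ℂ] H} {C : ℝ}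
    (h : HereditaryBounded c T C) : ∃ S, ConvergesSOT (fun n => (c n : ℂ)) T S := by
  -- Pair the block `z` of the series at `x` with itself and apply Cauchy–Schwarz: the factor in `z`
  -- is at most `√C * ‖z‖`, and one `‖z‖` cancels. The factor in `x` is a Cauchy block of a
  -- convergent scalar series.
  have hest : ∀ (x : H) (M N : ℕ), M ≤ N →
      ‖hereditaryPartialSum (fun n => (c n : ℂ)) T N x
        - hereditaryPartialSum (fun n => (c n : ℂ)) T M x‖
      ≤ √(∑ n ∈ Finset.Ico M N, |c n| * ‖(T ^ n) x‖ ^ 2) * √C := by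
    intro x M N hMN
    set z := hereditaryPartialSum (fun n => (c n : ℂ)) T N x
        - hereditaryPartialSum (fun n => (c n : ℂ)) T M x
    have hC : ∑ n ∈ Finset.Ico M N, |c n| * ‖(T ^ n) z‖ ^ 2 ≤ C * ‖z‖ ^ 2 := by
      refine le_trans ?_ (h z N)
      exact Finset.sum_le_sum_of_subset_of_nonneg
        (fun n hn => Finset.mem_range.2 (Finset.mem_Ico.1 hn).2) fun n _ _ => by positivity
    have h1 : ‖z‖ * ‖z‖ ≤ ∑ n ∈ Finset.Ico M N,
        (√|c n| * ‖(T ^ n) x‖) * (√|c n| * ‖(T ^ n) z‖) := by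
      rw [← inner_self_eq_norm_mul_norm (𝕜 := ℂ)]
      refine (Complex.re_le_norm _).trans ?_
      have : inner ℂ z z
          = ∑ n ∈ Finset.Ico M N, (c n : ℂ) * inner ℂ ((T ^ n) x) ((T ^ n) z) := by
        rw [Finset.sum_Ico_eq_sub _ hMN, ← inner_hereditaryPartialSum,
          ← inner_hereditaryPartialSum, ← inner_sub_left]
      rw [this]
      refine (norm_sum_le _ _).trans (Finset.sum_le_sum fun n _ => ?_)
      rw [norm_mul, Complex.norm_real, Real.norm_eq_abs]
      calc |c n| * ‖inner ℂ ((T ^ n) x) ((T ^ n) z)‖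
          ≤ |c n| * (‖(T ^ n) x‖ * ‖(T ^ n) z‖) := by
            gcongr; exact norm_inner_le_norm _ _
        _ = (√|c n| * √|c n|) * (‖(T ^ n) x‖ * ‖(T ^ n) z‖) := by
            rw [Real.mul_self_sqrt (abs_nonneg _)]
        _ = _ := by ring
    have h2 := h1.trans (Real.sum_mul_le_sqrt_mul_sqrt _ _ _)
    simp only [mul_pow, Real.sq_sqrt (abs_nonneg _)] at h2
    rcases (norm_nonneg z).eq_or_lt with hz | hz
    · rw [← hz]; positivity
    · refine le_of_mul_le_mul_right (h2.trans ?_) hz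
      rw [mul_assoc]
      gcongr
      refine (Real.sqrt_le_sqrt hC).trans_eq ?_
      rw [Real.sqrt_mul' _ (by positivity), Real.sqrt_sq hz.le]
  have hcauchy : ∀ x, CauchySeq fun N => hereditaryPartialSum (fun n => (c n : ℂ)) T N x := by
    intro x
    have hs := (h.summable x).hasSum.tendsto_sum_nat.cauchySeq
    rw [Metric.cauchySeq_iff'] at hs ⊢
    intro ε hε
    have hpos : 0 < (ε / (√C + 1)) ^ 2 := by positivity
    obtain ⟨M, hM⟩ := hs _ hpos
    refine ⟨M, fun N hN => ?_⟩
    rw [dist_eq_norm]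
    have h1 : ∑ n ∈ Finset.Ico M N, |c n| * ‖(T ^ n) x‖ ^ 2 < (ε / (√C + 1)) ^ 2 := by
      rw [Finset.sum_Ico_eq_sub _ hN]
      exact (le_abs_self _).trans_lt (hM N hN)
    have h2 : √(∑ n ∈ Finset.Ico M N, |c n| * ‖(T ^ n) x‖ ^ 2) ≤ ε / (√C + 1) := by
      rw [← Real.sqrt_sq (by positivity : 0 ≤ ε / (√C + 1))]
      exact Real.sqrt_le_sqrt h1.le
    calc _ ≤ _ := hest x M N hN
      _ ≤ ε / (√C + 1) * √C := by gcongr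
      _ < ε / (√C + 1) * (√C + 1) := by gcongr; linarith
      _ = ε := by field_simp
  choose f hf using fun x => cauchySeq_tendsto_of_complete (hcauchy x)
  -- Boundedness of the pointwise limit is Banach–Steinhaus.
  exact ⟨continuousLinearMapOfTendsto _ (tendsto_pi_nhds.2 hf), hf⟩

/-- Norm convergence of `∑ |c n| T*ⁿ Tⁿ` makes the tails of the quadratic forms uniformly small. -/
lemma ConvergesNorm.eventually_tail_le {c : ℕ → ℝ} {T S : H →L[ℂ] H}
    (h : ConvergesNorm (fun n => ((|c n| : ℝ) : ℂ)) T S) {ε : ℝ} (hε : 0 < ε) :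
    ∀ᶠ N in atTop, ∀ x, ∑' n, |c (n + N)| * ‖(T ^ (n + N)) x‖ ^ 2 ≤ ε * ‖x‖ ^ 2 := by
  have hS : ConvergesSOT (fun n => ((|c n| : ℝ) : ℂ)) T S := fun x =>
    ((ContinuousLinearMap.apply ℂ H x).continuous.tendsto S).comp h
  have hb : HereditaryBounded c T ‖S‖ := hS.hereditaryBounded
  filter_upwards [Metric.tendsto_nhds.1 h ε hε] with N hN x
  have h1 : inner ℂ (S x) x = ((∑' n, |c n| * ‖(T ^ n) x‖ ^ 2 : ℝ) : ℂ) :=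
    tendsto_nhds_unique (hS.tendsto_inner x)
      ((Complex.continuous_ofReal.tendsto _).comp (hb.summable x).hasSum.tendsto_sum_nat)
  have h2 : ((∑' n, |c (n + N)| * ‖(T ^ (n + N)) x‖ ^ 2 : ℝ) : ℂ)
      = inner ℂ ((S - hereditaryPartialSum (fun n => ((|c n| : ℝ) : ℂ)) T N) x) x := by
    rw [sub_apply, inner_sub_left, h1,
      inner_hereditaryPartialSum_self (fun n => |c n|), ← Complex.ofReal_sub,
      ← (hb.summable x).sum_add_tsum_nat_add N, add_sub_cancel_left]
  rw [dist_comm, dist_eq_norm] at hN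
  have h3 := congrArg norm h2
  rw [Complex.norm_real, Real.norm_of_nonneg (tsum_nonneg fun n => by positivity)] at h3
  rw [h3]
  refine (norm_inner_le_norm _ _).trans ?_
  calc _ ≤ ‖S - hereditaryPartialSum (fun n => ((|c n| : ℝ) : ℂ)) T N‖ * ‖x‖ * ‖x‖ := by
        gcongr; exact ContinuousLinearMap.le_opNorm _ x
    _ ≤ ε * ‖x‖ * ‖x‖ := by gcongr
    _ = _ := by ring

/-- A coercive quadratic form of a bounded operator is the square of an equivalent Hilbert norm. -/
lemma exists_equiv_norm_sq_eq {P : H →L[ℂ] H} {ψ : H → ℝ} {κ : ℝ} (hκ : 0 < κ)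
    (hP : ∀ x, inner ℂ (P x) x = (ψ x : ℂ)) (hψ : ∀ x, κ * ‖x‖ ^ 2 ≤ ψ x) :
    ∃ B : H ≃L[ℂ] H, ∀ x, ‖B x‖ ^ 2 = ψ x := by
  have hψ0 : ∀ x, 0 ≤ ψ x := fun x => le_trans (by positivity) (hψ x)
  have hpos : 0 ≤ P := by
    rw [ContinuousLinearMap.nonneg_iff_isPositive, ContinuousLinearMap.isPositive_iff_complex]
    intro x
    rw [hP x]
    simpa using hψ0 x
  have hunit : IsUnit P := by
    refine ContinuousLinearMap.isUnit_of_forall_le_norm_inner_map P (c := ⟨κ, hκ.le⟩) hκ fun x => ?_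
    rw [hP x, Complex.norm_real, Real.norm_of_nonneg (hψ0 x), mul_comm]
    exact hψ x
  -- `B` is the positive square root of `P`, invertible because coercivity makes `P` invertible.
  obtain ⟨U, hU⟩ := (CFC.isUnit_sqrt_iff P hpos).2 hunit
  refine ⟨ContinuousLinearEquiv.unitsEquiv ℂ H U, fun x => ?_⟩
  have hUx : ContinuousLinearEquiv.unitsEquiv ℂ H U x = CFC.sqrt P x := by rw [← hU]; rfl
  have hsa : ContinuousLinearMap.adjoint (CFC.sqrt P) = CFC.sqrt P :=
    (IsSelfAdjoint.of_nonneg (CFC.sqrt_nonneg P)).star_eq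
  have h1 : inner ℂ (CFC.sqrt P x) (CFC.sqrt P x) = (ψ x : ℂ) := by
    rw [← ContinuousLinearMap.adjoint_inner_left, hsa, ← mul_apply_eq_comp,
      CFC.sqrt_mul_sqrt_self P hpos, hP]
  rw [hUx]
  rw [inner_self_eq_norm_sq_to_K] at h1
  exact Complex.ofReal_injective (by rw [Complex.ofReal_pow]; exact h1)

/-! ### Growth of powers under the spectral hypothesis -/

/-- The powers of an operator with spectrum in the closed unit disc grow subexponentially. -/
lemma eventually_norm_pow_le_of_spectrum_subset {T : H →L[ℂ] H}
    (hT : spectrum ℂ T ⊆ Metric.closedBall (0 : ℂ) 1) {r : ℝ} (hr : 1 < r) :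
    ∀ᶠ n : ℕ in atTop, ‖T ^ n‖ ≤ r ^ n := by
  have hrad : spectralRadius ℂ T ≤ 1 := by
    refine iSup₂_le fun z hz => ?_
    have : ‖z‖ ≤ 1 := by simpa using hT hz
    exact_mod_cast this
  have hlt : spectralRadius ℂ T < ENNReal.ofReal r :=
    hrad.trans_lt (by rw [← ENNReal.ofReal_one]; exact (ENNReal.ofReal_lt_ofReal_iff (by linarith)).2 hr)
  filter_upwards [(spectrum.pow_nnnorm_pow_one_div_tendsto_nhds_spectralRadius T).eventually_lt_const
    hlt, eventually_gt_atTop 0] with n hn hn0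
  have hn0' : (0 : ℝ) < n := by exact_mod_cast hn0
  have h1 := ENNReal.rpow_le_rpow hn.le hn0'.le
  rw [← ENNReal.rpow_mul, one_div_mul_cancel hn0'.ne', ENNReal.rpow_one, ENNReal.rpow_natCast,
    ← ENNReal.ofReal_pow (by linarith)] at h1
  have h2 := ENNReal.toReal_mono ENNReal.ofReal_ne_top h1
  rwa [ENNReal.toReal_ofReal (by positivity)] at h2

/-- By Gelfand's formula `‖Tⁿ‖` is eventually at most `r ^ n` for some `r > 1` with `r ^ 2 < ρ`, so
a negative binomial series at `r ^ 2 / ρ < 1` dominates. -/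
lemma summable_choose_mul_norm_pow_sq {T : H →L[ℂ] H}
    (hT : spectrum ℂ T ⊆ Metric.closedBall (0 : ℂ) 1) {ρ : ℝ} (hρ : 1 < ρ) (K : ℕ) :
    Summable fun n : ℕ => ((n + K).choose K : ℝ) * ρ⁻¹ ^ n * ‖T ^ n‖ ^ 2 := by
  obtain ⟨r, hr1, hr⟩ : ∃ r : ℝ, 1 < r ∧ r ^ 2 < ρ := by
    have : Tendsto (fun r : ℝ => r ^ 2) (𝓝[>] 1) (𝓝 1) := by
      have hc : Continuous fun r : ℝ => r ^ 2 := by fun_prop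
      simpa using (hc.tendsto 1).mono_left nhdsWithin_le_nhds
    exact ((eventually_mem_nhdsWithin (s := Set.Ioi (1 : ℝ))).and
      (this.eventually_lt_const hρ)).exists
  have hx : ‖ρ⁻¹ * r ^ 2‖ < 1 := by
    rw [Real.norm_of_nonneg (by positivity), inv_mul_lt_one₀ (by linarith)]
    exact hr
  refine Summable.of_norm_bounded_eventually_nat
    (summable_choose_mul_geometric_of_norm_lt_one K hx) ?_
  filter_upwards [eventually_norm_pow_le_of_spectrum_subset hT hr1] with n hn
  rw [Real.norm_of_nonneg (by positivity), mul_assoc, mul_pow, ← pow_mul, mul_comm 2 n, pow_mul]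
  gcongr

end Forms

/-! ### Products of hereditary forms and averaging along orbits -/

section Similarity

variable {H : Type*} [NormedAddCommGroup H] [InnerProductSpace ℂ H]
variable {T : H →L[ℂ] H} {α β g : ℕ → ℝ} {Cα Cβ : ℝ}

lemma pow_add_apply (T : H →L[ℂ] H) (m n : ℕ) (x : H) :
    (T ^ (m + n)) x = (T ^ m) ((T ^ n) x) := by
  rw [pow_add, mul_apply_eq_comp]

lemma norm_pow_apply_sq_le (T : H →L[ℂ] H) (k : ℕ) (x : H) :
    ‖(T ^ k) x‖ ^ 2 ≤ ‖T ^ k‖ ^ 2 * ‖x‖ ^ 2 := by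
  rw [← mul_pow]
  gcongr
  exact (T ^ k).le_opNorm x

lemma HereditaryBounded.tsum_abs_le (h : HereditaryBounded β T Cβ) (x : H) :
    ∑' n, |β n| * ‖(T ^ n) x‖ ^ 2 ≤ Cβ * ‖x‖ ^ 2 :=
  Real.tsum_le_of_sum_range_le (fun n => by positivity) (h x)

lemma HereditaryBounded.abs_tsum_le (h : HereditaryBounded β T Cβ) (x : H) :
    |∑' n, β n * ‖(T ^ n) x‖ ^ 2| ≤ Cβ * ‖x‖ ^ 2 := by
  refine le_trans ?_ (h.tsum_abs_le x)
  have h1 : ∀ n, ‖β n * ‖(T ^ n) x‖ ^ 2‖ = |β n| * ‖(T ^ n) x‖ ^ 2 := fun n => by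
    rw [norm_mul, Real.norm_eq_abs, Real.norm_of_nonneg (by positivity)]
  have h2 := norm_tsum_le_tsum_norm (f := fun n => β n * ‖(T ^ n) x‖ ^ 2)
    ((h.summable x).congr fun n => (h1 n).symm)
  simpa only [h1, Real.norm_eq_abs] using h2

lemma HereditaryBounded.summable_prod (hα : HereditaryBounded α T Cα)
    (hβ : HereditaryBounded β T Cβ) (x : H) :
    Summable fun p : ℕ × ℕ => α p.1 * (β p.2 * ‖(T ^ (p.1 + p.2)) x‖ ^ 2) := by
  refine summable_mul_shift (u := fun n => ‖(T ^ n) x‖ ^ 2) (v := fun m => ‖(T ^ m) x‖ ^ 2)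
    (C := Cα) (fun n => by positivity) (fun m N => ?_) (hβ.summable x)
  simpa only [pow_add_apply] using hα ((T ^ m) x) N

lemma HereditaryBounded.abs (h : HereditaryBounded β T Cβ) :
    HereditaryBounded (fun n => |β n|) T Cβ := by
  simpa only [HereditaryBounded, abs_abs] using h

/-- Boundedness of the quadratic forms is inherited by Cauchy products. -/
lemma HereditaryBounded.cauchyProduct (hα : HereditaryBounded α T Cα)
    (hβ : HereditaryBounded β T Cβ) (hCβ : 0 ≤ Cβ) :
    HereditaryBounded
      (fun N => ∑ p ∈ Finset.HasAntidiagonal.antidiagonal N, α p.1 * β p.2) T (Cβ * Cα) := by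
  intro x N
  have h := hasSum_cauchyProduct_mul (α := fun n => |α n|) (β := fun n => |β n|)
    (u := fun n => ‖(T ^ n) x‖ ^ 2) (hα.abs.summable_prod hβ.abs x)
  have hle : ∀ n, ∑' m, |β m| * ‖(T ^ (n + m)) x‖ ^ 2 ≤ Cβ * ‖(T ^ n) x‖ ^ 2 := fun n => by
    simpa only [add_comm n, pow_add_apply] using hβ.tsum_abs_le ((T ^ n) x)
  calc ∑ n ∈ Finset.range N, |∑ p ∈ Finset.HasAntidiagonal.antidiagonal n, α p.1 * β p.2|
          * ‖(T ^ n) x‖ ^ 2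
      ≤ ∑ n ∈ Finset.range N,
          (∑ p ∈ Finset.HasAntidiagonal.antidiagonal n, |α p.1| * |β p.2|) * ‖(T ^ n) x‖ ^ 2 := by
        refine Finset.sum_le_sum fun n _ => ?_
        gcongr
        simpa only [abs_mul] using Finset.abs_sum_le_sum_abs (fun p : ℕ × ℕ => α p.1 * β p.2)
          (Finset.HasAntidiagonal.antidiagonal n)
    _ ≤ ∑' n, |α n| * ∑' m, |β m| * ‖(T ^ (n + m)) x‖ ^ 2 :=
        sum_le_hasSum _ (fun n _ => by positivity) h
    _ ≤ Cβ * (Cα * ‖x‖ ^ 2) := by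
        refine Real.tsum_le_of_sum_range_le
          (fun n => mul_nonneg (abs_nonneg _) (tsum_nonneg fun m => by positivity)) fun M => ?_
        calc ∑ n ∈ Finset.range M, |α n| * ∑' m, |β m| * ‖(T ^ (n + m)) x‖ ^ 2
            ≤ ∑ n ∈ Finset.range M, |α n| * (Cβ * ‖(T ^ n) x‖ ^ 2) := by
              gcongr with n _
              exact hle n
          _ = Cβ * ∑ n ∈ Finset.range M, |α n| * ‖(T ^ n) x‖ ^ 2 := by
              rw [Finset.mul_sum]
              exact Finset.sum_congr rfl fun n _ => by ring
          _ ≤ _ := by gcongr; exact hα x M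
    _ = _ := by ring

/-- The factorisation of power series read on forms: the second factor's form is evaluated along the
orbit and summed against the first. -/
lemma tsum_cauchyProduct_mul_norm_sq (hα : HereditaryBounded α T Cα)
    (hβ : HereditaryBounded β T Cβ) (x : H) :
    ∑' N, (∑ p ∈ Finset.HasAntidiagonal.antidiagonal N, α p.1 * β p.2) * ‖(T ^ N) x‖ ^ 2
      = ∑' n, α n * ∑' m, β m * ‖(T ^ m) ((T ^ n) x)‖ ^ 2 := by
  rw [(hasSum_cauchyProduct_mul (u := fun n => ‖(T ^ n) x‖ ^ 2) (hα.summable_prod hβ x)).tsum_eq]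
  simp only [← pow_add_apply, add_comm]

/-- If the Cauchy product of `α` and `β` gives a nonnegative form, then summing `α` against the
form of `β(T*, T)`, averaged over the powers of `T` with nonnegative weights, stays nonnegative. -/
lemma tsum_mul_weights_nonneg (hα : HereditaryBounded α T Cα) (hβ : HereditaryBounded β T Cβ)
    (hg : ∀ k, 0 ≤ g k) (hgT : Summable fun k => g k * ‖T ^ k‖ ^ 2)
    (hγ : ∀ x, 0 ≤ ∑' N, (∑ p ∈ Finset.HasAntidiagonal.antidiagonal N, α p.1 * β p.2)
      * ‖(T ^ N) x‖ ^ 2) (y : H) :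
    0 ≤ ∑' n, α n * ∑' k, g k * ∑' m, β m * ‖(T ^ m) ((T ^ k) ((T ^ n) y))‖ ^ 2 := by
  let φ : H → ℝ := fun x => ∑' m, β m * ‖(T ^ m) x‖ ^ 2
  have hs : Summable fun p : ℕ × ℕ => α p.1 * (g p.2 * ‖(T ^ (p.1 + p.2)) y‖ ^ 2) := by
    refine summable_mul_shift (u := fun n => ‖(T ^ n) y‖ ^ 2) (v := fun m => ‖(T ^ m) y‖ ^ 2)
      (C := Cα) (fun n => by positivity) (fun m N => ?_) ?_
    · simpa only [pow_add_apply] using hα ((T ^ m) y) N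
    · refine Summable.of_nonneg_of_le (fun k => by positivity) (fun k => ?_)
        (hgT.mul_right (‖y‖ ^ 2))
      rw [abs_of_nonneg (hg k), mul_assoc]
      exact mul_le_mul_of_nonneg_left (norm_pow_apply_sq_le T k y) (hg k)
  -- Since `|φ x| ≤ Cβ * ‖x‖²`, this is dominated by the previous family; it licenses the exchange
  -- of sums below.
  have hs' : Summable fun p : ℕ × ℕ => α p.1 * (g p.2 * φ ((T ^ (p.1 + p.2)) y)) := by
    refine Summable.of_norm_bounded (hs.abs.mul_left Cβ) fun p => ?_
    rw [Real.norm_eq_abs, abs_mul, abs_mul, abs_mul, abs_mul,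
      abs_of_nonneg (by positivity : 0 ≤ ‖(T ^ (p.1 + p.2)) y‖ ^ 2)]
    calc |α p.1| * (|g p.2| * |φ ((T ^ (p.1 + p.2)) y)|)
        ≤ |α p.1| * (|g p.2| * (Cβ * ‖(T ^ (p.1 + p.2)) y‖ ^ 2)) := by
          gcongr
          exact hβ.abs_tsum_le _
      _ = _ := by ring
  calc (0 : ℝ) ≤ ∑' k, g k * ∑' n, α n * φ ((T ^ n) ((T ^ k) y)) := by
        refine tsum_nonneg fun k => mul_nonneg (hg k) ?_
        rw [← tsum_cauchyProduct_mul_norm_sq hα hβ]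
        exact hγ _
    _ = ∑' k, ∑' n, α n * (g k * φ ((T ^ (n + k)) y)) := by
        refine tsum_congr fun k => ?_
        rw [← tsum_mul_left]
        refine tsum_congr fun n => ?_
        rw [pow_add_apply]
        ring
    _ = ∑' n, ∑' k, α n * (g k * φ ((T ^ (n + k)) y)) := hs'.tsum_comm
    _ = _ := by
        refine tsum_congr fun n => ?_
        rw [tsum_mul_left]
        simp only [add_comm n, pow_add_apply, φ]

variable [CompleteSpace H]

/-- Averaging the form of `∑ β n T*ⁿ Tⁿ` over the powers of `T` with suitable nonnegative weights
produces a coercive form. -/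
lemma exists_weights_coercive (hT : spectrum ℂ T ⊆ Metric.closedBall (0 : ℂ) 1)
    {S : H →L[ℂ] H} (hS : ConvergesNorm (fun n => ((|β n| : ℝ) : ℂ)) T S)
    (hβ : HereditaryBounded β T Cβ) (hsum : Summable fun n => |β n|)
    (hpos : ∀ t ∈ Set.Icc (0 : ℝ) 1, 0 < ∑' n, β n * t ^ n) :
    ∃ g : ℕ → ℝ, (∀ k, 0 ≤ g k) ∧ (Summable fun k => g k * ‖T ^ k‖ ^ 2) ∧
      ∃ κ : ℝ, 0 < κ ∧
        ∀ x, κ * ‖x‖ ^ 2 ≤ ∑' k, g k * ∑' m, β m * ‖(T ^ m) ((T ^ k) x)‖ ^ 2 := by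
  obtain ⟨δ, hδ, hev⟩ := exists_eventually_le_partialSum hsum hpos
  obtain ⟨d, ⟨hd, htail⟩, hd0⟩ :=
    ((hev.and (hS.eventually_tail_le hδ)).and (eventually_gt_atTop 0)).exists
  -- The same `δ` plays two roles: the truncated sum exceeds it on `[0, 1]`, so `q` stays positive
  -- there, and it dominates the tail of the form, so the form of `q` lies below that of `β`.
  let q : ℕ → ℝ := fun j => β j - if j = 0 then δ else 0
  have hqsum : ∀ w : ℕ → ℝ, ∑ j ∈ Finset.range d, q j * w j
      = ∑ j ∈ Finset.range d, β j * w j - δ * w 0 := by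
    intro w
    simp only [q, sub_mul, ite_mul, zero_mul, Finset.sum_sub_distrib, Finset.sum_ite_eq',
      Finset.mem_range, hd0, if_true]
  have hqpos : ∀ t ∈ Set.Icc (0 : ℝ) 1, 0 < ∑ j ∈ Finset.range d, q j * t ^ j := by
    intro t ht
    rw [hqsum, pow_zero, mul_one]
    exact sub_pos.2 (hd t ht)
  have hq0 : 0 < q 0 := by
    have := hqpos 0 ⟨le_rfl, zero_le_one⟩
    rwa [Finset.sum_eq_single_of_mem 0 (Finset.mem_range.2 hd0)
      (fun j _ hj => by rw [zero_pow hj, mul_zero]), pow_zero, mul_one] at this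
  obtain ⟨ρ, hρ, K, hK⟩ := exists_negBinomial_mul_coeff_nonneg d q hqpos
  let g : ℕ → ℝ := fun n => ((n + K).choose K : ℝ) * ρ⁻¹ ^ n
  have hg0 : ∀ k, 0 ≤ g k := fun k => by positivity
  have hgT : Summable fun k => g k * ‖T ^ k‖ ^ 2 := summable_choose_mul_norm_pow_sq hT hρ K
  have hlow : ∀ x, ∑ j ∈ Finset.range d, q j * ‖(T ^ j) x‖ ^ 2
      ≤ ∑' m, β m * ‖(T ^ m) x‖ ^ 2 := by
    intro x
    rw [hqsum, ← (hβ.summable_mul x).sum_add_tsum_nat_add d, sub_eq_add_neg]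
    gcongr
    have h1 : ∀ n, ‖β (n + d) * ‖(T ^ (n + d)) x‖ ^ 2‖ = |β (n + d)| * ‖(T ^ (n + d)) x‖ ^ 2 :=
      fun n => by rw [norm_mul, Real.norm_eq_abs, Real.norm_of_nonneg (by positivity)]
    have h2 := norm_tsum_le_tsum_norm (f := fun n => β (n + d) * ‖(T ^ (n + d)) x‖ ^ 2)
      (((summable_nat_add_iff d).2 (hβ.summable x)).congr fun n => (h1 n).symm)
    simp only [h1, Real.norm_eq_abs] at h2
    have h3 := htail x
    rw [pow_zero, one_apply_eq_self]
    have := (abs_le.1 (h2.trans h3)).1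
    exact this
  have hshift : ∀ (x : H) (j : ℕ), Summable fun k => g k * ‖(T ^ (k + j)) x‖ ^ 2 := by
    intro x j
    refine Summable.of_nonneg_of_le (fun k => mul_nonneg (hg0 k) (by positivity)) (fun k => ?_)
      (hgT.mul_right (‖(T ^ j) x‖ ^ 2))
    rw [pow_add_apply, mul_assoc (g k)]
    exact mul_le_mul_of_nonneg_left (norm_pow_apply_sq_le T k _) (hg0 k)
  refine ⟨g, hg0, hgT, q 0 * g 0, mul_pos hq0 (by simp [g]), fun x => ?_⟩
  have h1 := mul_le_tsum_mul_polynomial_shift (u := fun n => ‖(T ^ n) x‖ ^ 2)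
    (fun n => by positivity) hd0 (hshift x) hK
  simp only [pow_zero, one_apply_eq_self] at h1
  refine h1.trans (Summable.tsum_le_tsum (fun k => ?_) ?_ ?_)
  · refine mul_le_mul_of_nonneg_left ?_ (hg0 k)
    simpa only [add_comm k, pow_add_apply] using hlow ((T ^ k) x)
  · simp only [Finset.mul_sum]
    refine summable_sum fun j _ => ((hshift x j).mul_left (q j)).congr fun k => by ring
  · refine Summable.of_norm_bounded ((hshift x 0).mul_left Cβ) fun k => ?_
    rw [norm_mul, Real.norm_of_nonneg (hg0 k), Real.norm_eq_abs]
    calc g k * |∑' m, β m * ‖(T ^ m) ((T ^ k) x)‖ ^ 2|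
        ≤ g k * (Cβ * ‖(T ^ k) x‖ ^ 2) :=
          mul_le_mul_of_nonneg_left (hβ.abs_tsum_le _) (hg0 k)
      _ = _ := by rw [add_zero]; ring

/-- The averaged form comes from `∑ g k • T*ᵏ G Tᵏ`, which converges in norm because `∑ g k ‖Tᵏ‖²`
is finite. -/
lemma exists_operator_of_weights {G : H →L[ℂ] H} {φ : H → ℝ}
    (hG : ∀ x, inner ℂ (G x) x = (φ x : ℂ)) (hg : ∀ k, 0 ≤ g k)
    (hgT : Summable fun k => g k * ‖T ^ k‖ ^ 2) :
    ∃ P : H →L[ℂ] H, ∀ x, inner ℂ (P x) x = ((∑' k, g k * φ ((T ^ k) x) : ℝ) : ℂ) := by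
  let F : ℕ → H →L[ℂ] H := fun k =>
    (g k : ℂ) • (ContinuousLinearMap.adjoint (T ^ k) * G * T ^ k)
  have hF : Summable F := by
    refine Summable.of_norm_bounded (hgT.mul_left ‖G‖) fun k => ?_
    rw [norm_smul, Complex.norm_real, Real.norm_of_nonneg (hg k)]
    calc g k * ‖ContinuousLinearMap.adjoint (T ^ k) * G * T ^ k‖
        ≤ g k * (‖T ^ k‖ * ‖G‖ * ‖T ^ k‖) := by
          refine mul_le_mul_of_nonneg_left ?_ (hg k)
          refine (norm_mul_le _ _).trans ?_
          gcongr
          refine (norm_mul_le _ _).trans_eq ?_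
          rw [LinearIsometryEquiv.norm_map]
      _ = _ := by ring
  refine ⟨∑' k, F k, fun x => ?_⟩
  have h1 : HasSum (fun k => inner ℂ x (F k x)) (inner ℂ x ((∑' k, F k) x)) :=
    hF.hasSum.mapL ((innerSL ℂ x).comp (ContinuousLinearMap.apply ℂ H x))
  have h2 : ∀ k, inner ℂ x (F k x) = ((g k * φ ((T ^ k) x) : ℝ) : ℂ) := by
    intro k
    have h3 : inner ℂ ((T ^ k) x) (G ((T ^ k) x)) = (φ ((T ^ k) x) : ℂ) := by
      rw [← inner_conj_symm, hG, Complex.conj_ofReal]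
    simp only [F, smul_apply, mul_apply_eq_comp, inner_smul_right,
      ContinuousLinearMap.adjoint_inner_right, h3, Complex.ofReal_mul]
  simp only [h2] at h1
  rw [← inner_conj_symm, ← h1.tsum_eq, ← Complex.ofReal_tsum, Complex.conj_ofReal]

end Similarity

/-! ### The similarity theorem -/

theorem corollary1p2 {H : Type*} [NormedAddCommGroup H] [InnerProductSpace ℂ H]
    [CompleteSpace H] [TopologicalSpace.SeparableSpace H]
    (That : H →L[ℂ] H) (hspec : spectrum ℂ That ⊆ Metric.closedBall (0 : ℂ) 1)
    (a : ℝ) (ha : 0 < a) (γ γt : ℂ → ℂ)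
    (hγ : ∀ t : ℂ, ‖t‖ < 1 → γ t = oneSubPow a t * γt t)
    (hα : MemAReal That (oneSubPow a))
    (hγt : MemA0Real That γt)
    (hpos : ∀ t : ℝ, t ∈ Set.Icc (0 : ℝ) 1 → 0 < (γt (t : ℂ)).re)
    (hnonneg : (hereditary γ That).IsPositive) :
    ∃ T : H →L[ℂ] H, IsSimilarOp That T ∧ IsAContraction a T := by
  obtain ⟨⟨hαW, Sα, hSα⟩, hαR⟩ := hα
  obtain ⟨⟨hβW, Sβ, hSβ⟩, hβR⟩ := hγt
  set α : ℕ → ℝ := fun n => (taylorCoeff (oneSubPow a) n).re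
  set β : ℕ → ℝ := fun n => (taylorCoeff γt n).re
  have hαc : taylorCoeff (oneSubPow a) = fun n => (α n : ℂ) :=
    funext fun n => (hαR.ofReal_re n).symm
  have hβc : taylorCoeff γt = fun n => (β n : ℂ) := funext fun n => (hβR.ofReal_re n).symm
  simp only [hαR.norm_taylorCoeff] at hSα
  simp only [hβR.norm_taylorCoeff] at hSβ
  have hα : HereditaryBounded α That ‖Sα‖ := ConvergesSOT.hereditaryBounded hSα
  have hβ : HereditaryBounded β That ‖Sβ‖ := ConvergesSOT.hereditaryBounded fun x =>
    ((ContinuousLinearMap.apply ℂ H x).continuous.tendsto Sβ).comp hSβ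
  -- the coefficients of `γ`
  have hγc : taylorCoeff γ = fun N =>
      ((∑ p ∈ Finset.HasAntidiagonal.antidiagonal N, α p.1 * β p.2 : ℝ) : ℂ) := by
    funext N
    -- Taylor coefficients at `0` depend only on the germ, so the identity on the open disc
    -- suffices.
    have heq : γ =ᶠ[𝓝 0] fun t => oneSubPow a t * γt t := by
      filter_upwards [Metric.ball_mem_nhds (0 : ℂ) one_pos] with t ht
      exact hγ t (mem_ball_zero_iff.1 ht)
    have h1 : taylorCoeff γ N = taylorCoeff (fun t => oneSubPow a t * γt t) N := by
      rw [taylorCoeff, taylorCoeff, heq.iteratedDeriv_eq]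
    rw [h1, taylorCoeff_mul hαW.analyticAt_zero hβW.analyticAt_zero, hαc, hβc]
    push_cast
    rfl
  have hγb := hα.cauchyProduct hβ (norm_nonneg _)
  have hγpos : ∀ x, 0 ≤ ∑' N, (∑ p ∈ Finset.HasAntidiagonal.antidiagonal N, α p.1 * β p.2)
      * ‖(That ^ N) x‖ ^ 2 := by
    -- Convergence is needed before the positivity hypothesis says anything: otherwise `hereditary`
    -- could be its default value `0`.
    have hex : HereditaryConverges γ That := by
      rw [HereditaryConverges, hγc]
      exact hγb.exists_convergesSOT
    rw [hereditary, dif_pos hex] at hnonneg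
    have hspecS := hex.choose_spec
    generalize hex.choose = S at hspecS hnonneg
    rw [hγc] at hspecS
    exact (hγb.isPositive_iff hspecS).1 hnonneg
  -- the coercive form
  have hβsum : Summable fun n => |β n| := by
    simpa only [hβR.norm_taylorCoeff] using hβW.summable
  have hβpos : ∀ t ∈ Set.Icc (0 : ℝ) 1, 0 < ∑' n, β n * t ^ n := by
    intro t ht
    have h1 := hβW.hasSum (t : ℂ) (by
      rw [Complex.norm_real, Real.norm_of_nonneg ht.1]; exact ht.2)
    have h2 := Complex.hasSum_re h1
    have h3 : ∀ n, (taylorCoeff γt n * (t : ℂ) ^ n).re = β n * t ^ n := fun n => by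
      rw [← Complex.ofReal_pow, Complex.re_mul_ofReal]
    simp only [h3] at h2
    rw [h2.tsum_eq]
    exact hpos t ht
  obtain ⟨g, hg, hgT, κ, hκ, hcoer⟩ := exists_weights_coercive hspec hSβ hβ hβsum hβpos
  obtain ⟨G, hG⟩ := hβ.exists_convergesSOT
  obtain ⟨P, hP⟩ := exists_operator_of_weights (fun x => hβ.inner_eq_tsum hG x) hg hgT
  obtain ⟨B, hB⟩ := exists_equiv_norm_sq_eq hκ hP hcoer
  -- the similar operator
  let T : H →L[ℂ] H := (B : H →L[ℂ] H) ∘L That ∘L (B.symm : H →L[ℂ] H)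
  have hpow : ∀ (n : ℕ) (x : H), (T ^ n) x = B ((That ^ n) (B.symm x)) := by
    intro n
    induction n with
    | zero => simp
    | succ n ih =>
      intro x
      rw [pow_succ, mul_apply_eq_comp, ih, pow_succ, mul_apply_eq_comp]
      simp [T]
  have hTb : HereditaryBounded α T
      (‖(B : H →L[ℂ] H)‖ ^ 2 * (‖Sα‖ * ‖(B.symm : H →L[ℂ] H)‖ ^ 2)) := by
    intro x N
    calc ∑ n ∈ Finset.range N, |α n| * ‖(T ^ n) x‖ ^ 2
        ≤ ∑ n ∈ Finset.range N,
            |α n| * (‖(B : H →L[ℂ] H)‖ * ‖(That ^ n) (B.symm x)‖) ^ 2 := by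
          gcongr with n _
          rw [hpow]
          exact (B : H →L[ℂ] H).le_opNorm _
      _ = ‖(B : H →L[ℂ] H)‖ ^ 2
            * ∑ n ∈ Finset.range N, |α n| * ‖(That ^ n) (B.symm x)‖ ^ 2 := by
          rw [Finset.mul_sum]
          exact Finset.sum_congr rfl fun n _ => by ring
      _ ≤ ‖(B : H →L[ℂ] H)‖ ^ 2 * (‖Sα‖ * ‖B.symm x‖ ^ 2) := by
          gcongr
          exact hα _ _
      _ ≤ ‖(B : H →L[ℂ] H)‖ ^ 2 * (‖Sα‖ * (‖(B.symm : H →L[ℂ] H)‖ * ‖x‖) ^ 2) := by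
          gcongr
          exact (B.symm : H →L[ℂ] H).le_opNorm _
      _ = _ := by ring
  have hex : HereditaryConverges (oneSubPow a) T := by
    rw [HereditaryConverges, hαc]
    exact hTb.exists_convergesSOT
  refine ⟨T, ⟨B, rfl⟩, hex, ?_⟩
  rw [hereditary, dif_pos hex]
  have hspecS := hex.choose_spec
  generalize hex.choose = S at hspecS ⊢
  rw [hαc] at hspecS
  refine (hTb.isPositive_iff hspecS).2 fun x => ?_
  -- As `‖B x‖² = ψ x`, the form of `(1 - t)ᵃ(T*, T)` at `x` becomes `∑ α n ψ(T̂ⁿ y)` with `y = B⁻¹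
  -- x`.
  simp only [hpow, hB]
  exact tsum_mul_weights_nonneg hα hβ hg hgT hγpos (B.symm x)
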